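/- Let $K$ be an infinite field. (1) If $L/K$ is a separable field extension of degree $5$, then there is an element $x \in L$ with $L = K(x)$ whose minimal polynomial over $K$ has the form $$X^5 + bX^3 + cX + d \qquad (b, c, d \in K).$$ (2) If $L/K$ is a separable field extension of degree $6$ and $\operatorname{char} K \neq 2$, then there is an element $x \in L$ with $L = K(x)$ whose minimal polynomial over $K$ has the form $$X^6 + bX^4 + cX^2 + dX + e \qquad (b, c, d, e \in K).$$ -/

import Mathlib

open scoped Polynomial

/-! ### Covariants at a root, and their sums over pairs of roots -/

section Covariants

/-! The element sought is a Tschirnhaus transform of a generic `x` in `L`. With `P` the minimal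
polynomial of `x`, put `y = q(P'(x), P''(x)/2, ...) / P'(x)`, where `q` comes from a classical
covariant of the quintic or sextic; Hasse derivatives make this free of characteristic. The
conjugates of `y` are the values `u_i` of the same expression at the roots `x_i`, so it suffices
that `e_1(u) = e_3(u) = 0` and that the `u_i` are distinct.

The vanishing rests on a factorization: `u_i + u_j` is, up to explicit differences of roots, a
product of three involution determinants, one for each way to split the other roots into pairs
(`covariant_sextic_add`; for the quintic one root is doubled, `covariant_quintic_add`). Grouping the
roots in pairs gives `e_1 = 0`. Modulo `e_1`, the vanishing of `e_3` becomes
`(u_0+u_1)(u_0+u_2)(u_1+u_2) + (u_3+u_4)(u_3+u_5)(u_4+u_5) = 0` (with `u_5 = 0` for the quintic),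
and both products involve the same nine determinants.

Distinctness holds for some `x` because the conjugate vectors of elements of `L` are Zariski dense
(`exists_eval_embeddings_ne_zero`) and no `u_i - u_j` vanishes identically
(`covariantDiff_X_ne_zero`). -/

/-- The value at `r` of the polynomial expression `q` in the first four Hasse derivatives of `P`. -/
noncomputable def covariantNum {R : Type*} [CommRing R] (q : MvPolynomial (Fin 4) ℤ) (P : R[X])
    (r : R) : R :=
  MvPolynomial.aeval (fun k : Fin 4 => (Polynomial.hasseDeriv (k + 1) P).eval r) q

/-- The quotient of `covariantNum q P r` by the derivative of `P` at `r`. -/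
noncomputable def covariant {F : Type*} [Field F] (q : MvPolynomial (Fin 4) ℤ) (P : F[X])
    (r : F) : F :=
  covariantNum q P r / (Polynomial.hasseDeriv 1 P).eval r

theorem eval_hasseDeriv_map {R S : Type*} [CommRing R] [CommRing S] (f : R →+* S) (P : R[X])
    (r : R) (k : ℕ) : (Polynomial.hasseDeriv k (P.map f)).eval (f r)
      = f ((Polynomial.hasseDeriv k P).eval r) := by
  rw [← Polynomial.taylor_coeff, ← Polynomial.taylor_coeff, ← Polynomial.map_taylor,
    Polynomial.coeff_map]

theorem map_covariantNum {R S : Type*} [CommRing R] [CommRing S] (f : R →+* S)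
    (q : MvPolynomial (Fin 4) ℤ) (P : R[X]) (r : R) :
    f (covariantNum q P r) = covariantNum q (P.map f) (f r) := by
  unfold covariantNum
  simp only [eval_hasseDeriv_map]
  change f (MvPolynomial.eval₂ _ _ _) = MvPolynomial.eval₂ _ _ _
  rw [MvPolynomial.eval₂_comp_left f]
  congr 1
  exact RingHom.ext_int _ _

theorem map_covariant {F E : Type*} [Field F] [Field E] (f : F →+* E)
    (q : MvPolynomial (Fin 4) ℤ) (P : F[X]) (r : F) :
    f (covariant q P r) = covariant q (P.map f) (f r) := by
  unfold covariant
  rw [map_div₀, map_covariantNum, eval_hasseDeriv_map]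

/-- The cubic covariant of degree three of the binary quintic, in terms of Taylor coefficients
at a root. -/
noncomputable def quinticCovariant : MvPolynomial (Fin 4) ℤ :=
  .X 1 ^ 3 - 4 * .X 0 * .X 1 * .X 2 + 8 * .X 0 ^ 2 * .X 3

/-- The quartic covariant of degree two of the binary sextic, in terms of Taylor coefficients
at a root. -/
noncomputable def sexticCovariant : MvPolynomial (Fin 4) ℤ :=
  2 * .X 1 ^ 2 - 5 * .X 0 * .X 2

variable {F : Type*} [Field F]

/-- The determinant of the three quadratics with roots `a, b`, with roots `c, d` and with
roots `e, f`; it vanishes when the three pairs are in involution. -/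
def involutionDet (a b c d e f : F) : F :=
  (c + d) * (e * f) - (c * d) * (e + f) - (a + b) * (e * f - c * d) + a * b * (e + f - c - d)

open Polynomial

theorem eval_hasseDeriv_of_eq_quintic {P : F[X]} {r a b c d : F}
    (hP : P = (X - C r) * (X - C a) * (X - C b) * (X - C c) * (X - C d)) :
    (hasseDeriv 1 P).eval r = (r - a) * (r - b) * (r - c) * (r - d) ∧
    (hasseDeriv 2 P).eval r = (r - a) * (r - b) * (r - c) + (r - a) * (r - b) * (r - d)
      + (r - a) * (r - c) * (r - d) + (r - b) * (r - c) * (r - d) ∧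
    (hasseDeriv 3 P).eval r = (r - a) * (r - b) + (r - a) * (r - c) + (r - a) * (r - d)
      + (r - b) * (r - c) + (r - b) * (r - d) + (r - c) * (r - d) ∧
    (hasseDeriv 4 P).eval r = (r - a) + (r - b) + (r - c) + (r - d) := by
  have h : taylor r P = X * (X + C (r - a)) * (X + C (r - b)) * (X + C (r - c))
      * (X + C (r - d)) := by
    simp only [hP, taylor_mul, map_sub, taylor_X, taylor_C]
    ring
  generalize r - a = a at *
  generalize r - b = b at *
  generalize r - c = c at *
  generalize r - d = d at *
  have h' : taylor r P = C (a * b * c * d) * X ^ 1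
      + C (a * b * c + a * b * d + a * c * d + b * c * d) * X ^ 2
      + C (a * b + a * c + a * d + b * c + b * d + c * d) * X ^ 3 + C (a + b + c + d) * X ^ 4
      + X ^ 5 := by
    rw [h]
    simp only [C_add, C_mul]
    ring
  simp only [← taylor_coeff, h', coeff_add, coeff_C_mul, coeff_X_pow]
  norm_num

theorem eval_hasseDeriv_of_eq_sextic {P : F[X]} {r a b c d e : F}
    (hP : P = (X - C r) * (X - C a) * (X - C b) * (X - C c) * (X - C d) * (X - C e)) :
    (hasseDeriv 1 P).eval r = (r - a) * ((r - b) * (r - c) * (r - d) * (r - e)) ∧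
    (hasseDeriv 2 P).eval r = (r - b) * (r - c) * (r - d) * (r - e)
      + (r - a) * ((r - b) * (r - c) * (r - d) + (r - b) * (r - c) * (r - e)
        + (r - b) * (r - d) * (r - e) + (r - c) * (r - d) * (r - e)) ∧
    (hasseDeriv 3 P).eval r = ((r - b) * (r - c) * (r - d) + (r - b) * (r - c) * (r - e)
        + (r - b) * (r - d) * (r - e) + (r - c) * (r - d) * (r - e))
      + (r - a) * ((r - b) * (r - c) + (r - b) * (r - d) + (r - b) * (r - e)
        + (r - c) * (r - d) + (r - c) * (r - e) + (r - d) * (r - e)) := by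
  have h : taylor r P = X * (X + C (r - a)) * (X + C (r - b)) * (X + C (r - c))
      * (X + C (r - d)) * (X + C (r - e)) := by
    simp only [hP, taylor_mul, map_sub, taylor_X, taylor_C]
    ring
  generalize r - a = a at *
  generalize r - b = b at *
  generalize r - c = c at *
  generalize r - d = d at *
  generalize r - e = e at *
  have h' : taylor r P = C (a * (b * c * d * e)) * X ^ 1
      + C (b * c * d * e + a * (b * c * d + b * c * e + b * d * e + c * d * e)) * X ^ 2
      + C ((b * c * d + b * c * e + b * d * e + c * d * e)
        + a * (b * c + b * d + b * e + c * d + c * e + d * e)) * X ^ 3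
      + C (a * (b + c + d + e) + (b * c + b * d + b * e + c * d + c * e + d * e)) * X ^ 4
      + C (a + b + c + d + e) * X ^ 5 + X ^ 6 := by
    rw [h]
    simp only [C_add, C_mul]
    ring
  simp only [← taylor_coeff, h', coeff_add, coeff_C_mul, coeff_X_pow]
  norm_num

/-- In the inverses `t_i` of `r - a, ..., r - d`, the numerator is a power of `P'(r)` times `e_1^3 -
4 e_1 e_2 + 8 e_3`, which is the product of the three forms `t_1 + t_2 - t_3 - t_4`. Each form is,
up to scaling, one determinant with the pair `r, r`. -/
theorem covariant_quintic_eq {P : F[X]} {r a b c d : F}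
    (hP : P = (X - C r) * (X - C a) * (X - C b) * (X - C c) * (X - C d)) :
    covariant quinticCovariant P r = -(involutionDet r r a b c d * involutionDet r r a c b d
      * involutionDet r r a d b c) / ((r - a) * (r - b) * (r - c) * (r - d)) := by
  obtain ⟨h1, h2, h3, h4⟩ := eval_hasseDeriv_of_eq_quintic hP
  simp only [covariant, covariantNum, quinticCovariant, map_sub, map_add, map_mul, map_pow,
    MvPolynomial.aeval_X, map_ofNat]
  simp only [Fin.val_zero, Fin.val_one, Fin.val_two, show ((3 : Fin 4) : ℕ) = 3 from rfl,
    zero_add, Nat.reduceAdd, h1, h2, h3, h4]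
  congr 1
  unfold involutionDet
  ring

theorem covariant_quintic_add {P : F[X]} {a b c d e : F}
    (hP : P = (X - C a) * (X - C b) * (X - C c) * (X - C d) * (X - C e))
    (hab : a - b ≠ 0) (hac : a - c ≠ 0) (had : a - d ≠ 0) (hae : a - e ≠ 0)
    (hbc : b - c ≠ 0) (hbd : b - d ≠ 0) (hbe : b - e ≠ 0) :
    covariant quinticCovariant P a + covariant quinticCovariant P b =
      -((a - b) ^ 2 * (involutionDet a b c c d e * involutionDet a b d d c e
        * involutionDet a b e e c d))
      / ((a - c) * (a - d) * (a - e) * ((b - c) * (b - d) * (b - e))) := by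
  have hP' : P = (X - C b) * (X - C a) * (X - C c) * (X - C d) * (X - C e) := by rw [hP]; ring
  rw [covariant_quintic_eq hP, covariant_quintic_eq hP', ← neg_sub a b]
  -- Everything is translation invariant, so differences from `a` serve as coordinates; this
  -- simplifies the denominators.
  obtain ⟨h, rfl⟩ : ∃ h, b = a - h := ⟨a - b, by ring⟩
  obtain ⟨c, rfl⟩ : ∃ h, c = a - h := ⟨a - c, by ring⟩
  obtain ⟨d, rfl⟩ : ∃ h, d = a - h := ⟨a - d, by ring⟩
  obtain ⟨e, rfl⟩ : ∃ h, e = a - h := ⟨a - e, by ring⟩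
  simp only [sub_sub_cancel, sub_sub_sub_cancel_left] at *
  unfold involutionDet
  field_simp
  ring

/-- The three determinants correspond to the three partitions of the six roots into pairs that
contain `{a, b}`. -/
theorem covariant_sextic_add {P : F[X]} {a b c d e f : F}
    (hP : P = (X - C a) * (X - C b) * (X - C c) * (X - C d) * (X - C e) * (X - C f))
    (hab : a - b ≠ 0) (hac : a - c ≠ 0) (had : a - d ≠ 0) (hae : a - e ≠ 0) (haf : a - f ≠ 0)
    (hbc : b - c ≠ 0) (hbd : b - d ≠ 0) (hbe : b - e ≠ 0) (hbf : b - f ≠ 0) :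
    covariant sexticCovariant P a + covariant sexticCovariant P b =
      2 * ((a - b) ^ 2 * (involutionDet a b c d e f * involutionDet a b c e d f
        * involutionDet a b c f d e))
      / ((a - c) * (a - d) * (a - e) * (a - f)
        * ((b - c) * (b - d) * (b - e) * (b - f))) := by
  have hP' : P = (X - C b) * (X - C a) * (X - C c) * (X - C d) * (X - C e) * (X - C f) := by
    rw [hP]; ring
  obtain ⟨h1, h2, h3⟩ := eval_hasseDeriv_of_eq_sextic hP
  obtain ⟨h1', h2', h3'⟩ := eval_hasseDeriv_of_eq_sextic hP'
  simp only [covariant, covariantNum, sexticCovariant, map_sub, map_mul, map_pow,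
    MvPolynomial.aeval_X, map_ofNat]
  simp only [Fin.val_zero, Fin.val_one, Fin.val_two,
    zero_add, Nat.reduceAdd, h1, h2, h3, h1', h2', h3']
  clear h1 h2 h3 h1' h2' h3' hP hP'
  rw [← neg_sub a b]
  obtain ⟨h, rfl⟩ : ∃ h, b = a - h := ⟨a - b, by ring⟩
  obtain ⟨c, rfl⟩ : ∃ h, c = a - h := ⟨a - c, by ring⟩
  obtain ⟨d, rfl⟩ : ∃ h, d = a - h := ⟨a - d, by ring⟩
  obtain ⟨e, rfl⟩ : ∃ h, e = a - h := ⟨a - e, by ring⟩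
  obtain ⟨f, rfl⟩ : ∃ h, f = a - h := ⟨a - f, by ring⟩
  simp only [sub_sub_cancel, sub_sub_sub_cancel_left] at *
  unfold involutionDet
  field_simp
  ring

end Covariants

/-! ### Vanishing of the first and third elementary symmetric functions -/

section Identities

open Polynomial

variable {F : Type*} [Field F]

/-- These two symmetries bring determinants of the same three pairs to one literal form, so that
they can be treated as a single symbol. -/
theorem involutionDet_rotate (a b c d e f : F) :
    involutionDet a b c d e f = involutionDet c d e f a b := by
  unfold involutionDet; ring

theorem involutionDet_swap (a b c d e f : F) :
    involutionDet a b c d e f = -involutionDet c d a b e f := by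
  unfold involutionDet; ring

theorem neg_sub_ne_zero {a b : F} (h : a - b ≠ 0) : b - a ≠ 0 := by
  rw [← neg_sub]; exact neg_ne_zero.2 h

/-- Grouped as `a`, `{b, c}`, `{d, e}`, the three terms share the determinant of the pairs `aa`,
`bc`, `de`. Dividing it out leaves the smaller identity `key`. -/
theorem covariant_quintic_sum {P : F[X]} {a b c d e : F}
    (hP : P = (X - C a) * (X - C b) * (X - C c) * (X - C d) * (X - C e))
    (hab : a - b ≠ 0) (hac : a - c ≠ 0) (had : a - d ≠ 0) (hae : a - e ≠ 0) (hbc : b - c ≠ 0)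
    (hbd : b - d ≠ 0) (hbe : b - e ≠ 0) (hcd : c - d ≠ 0) (hce : c - e ≠ 0) (hde : d - e ≠ 0) :
    covariant quinticCovariant P a + covariant quinticCovariant P b
    + covariant quinticCovariant P c + covariant quinticCovariant P d
    + covariant quinticCovariant P e = 0 := by
  have h0 := covariant_quintic_eq (P := P) (r := a) (a := b) (b := c) (c := d) (d := e) hP
  have h1 := covariant_quintic_add (P := P) (a := b) (b := c) (c := a) (d := d) (e := e)
    (by rw [hP]; ring) hbc (neg_sub_ne_zero hab) hbd hbe (neg_sub_ne_zero hac) hcd hce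
  rw [involutionDet_swap b c a a d e] at h1
  rw [← neg_sub a b, ← neg_sub a c] at h1
  have h2 := covariant_quintic_add (P := P) (a := d) (b := e) (c := a) (d := b) (e := c)
    (by rw [hP]; ring) hde (neg_sub_ne_zero had) (neg_sub_ne_zero hbd) (neg_sub_ne_zero hcd)
    (neg_sub_ne_zero hae) (neg_sub_ne_zero hbe) (neg_sub_ne_zero hce)
  rw [involutionDet_rotate d e a a b c] at h2
  rw [← neg_sub a d, ← neg_sub b d, ← neg_sub c d, ← neg_sub a e, ← neg_sub b e,
    ← neg_sub c e] at h2
  have key : involutionDet a a b d c e * involutionDet a a b e c d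
        * ((b - d) * (b - e) * (c - d) * (c - e))
      - (b - c) ^ 2 * (involutionDet b c d d a e * involutionDet b c e e a d)
        * ((a - d) * (a - e))
      + (d - e) ^ 2 * (involutionDet d e b b a c * involutionDet d e c c a b)
        * ((a - b) * (a - c)) = 0 := by
    unfold involutionDet; ring
  generalize involutionDet a a b c d e = I0 at *
  generalize involutionDet a a b d c e = I1 at *
  generalize involutionDet a a b e c d = I2 at *
  generalize involutionDet b c d d a e = I3 at *
  generalize involutionDet b c e e a d = I4 at *
  generalize involutionDet d e b b a c = I5 at *
  generalize involutionDet d e c c a b = I6 at *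
  generalize a - b = ab at *
  generalize a - c = ac at *
  generalize a - d = ad at *
  generalize a - e = ae at *
  generalize b - c = bc at *
  generalize b - d = bd at *
  generalize b - e = be at *
  generalize c - d = cd at *
  generalize c - e = ce at *
  generalize d - e = de at *
  rw [show ∀ x y z u v : F, x + y + z + u + v = x + (y + z) + (u + v) by intros; ring, h0, h1, h2]
  field_simp
  linear_combination (-I0) * key

/-- The sums over `{a, b}`, `{c, d}`, `{e, f}` share the determinant of these three pairs. -/
theorem covariant_sextic_sum {P : F[X]} {a b c d e f : F}
    (hP : P = (X - C a) * (X - C b) * (X - C c) * (X - C d) * (X - C e) * (X - C f))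
    (hab : a - b ≠ 0) (hac : a - c ≠ 0) (had : a - d ≠ 0) (hae : a - e ≠ 0) (haf : a - f ≠ 0)
    (hbc : b - c ≠ 0) (hbd : b - d ≠ 0) (hbe : b - e ≠ 0) (hbf : b - f ≠ 0) (hcd : c - d ≠ 0)
    (hce : c - e ≠ 0) (hcf : c - f ≠ 0) (hde : d - e ≠ 0) (hdf : d - f ≠ 0) (hef : e - f ≠ 0) :
    covariant sexticCovariant P a + covariant sexticCovariant P b
    + covariant sexticCovariant P c + covariant sexticCovariant P d
    + covariant sexticCovariant P e + covariant sexticCovariant P f = 0 := by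
  have h0 := covariant_sextic_add (P := P) (a := a) (b := b) (c := c) (d := d) (e := e) (f := f)
    hP hab hac had hae haf hbc hbd hbe hbf
  have h1 := covariant_sextic_add (P := P) (a := c) (b := d) (c := a) (d := b) (e := e) (f := f)
    (by rw [hP]; ring) hcd (neg_sub_ne_zero hac) (neg_sub_ne_zero hbc) hce hcf
    (neg_sub_ne_zero had) (neg_sub_ne_zero hbd) hde hdf
  rw [involutionDet_swap c d a b e f] at h1
  rw [← neg_sub a c, ← neg_sub b c, ← neg_sub a d, ← neg_sub b d] at h1
  have h2 := covariant_sextic_add (P := P) (a := e) (b := f) (c := a) (d := b) (e := c) (f := d)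
    (by rw [hP]; ring) hef (neg_sub_ne_zero hae) (neg_sub_ne_zero hbe) (neg_sub_ne_zero hce)
    (neg_sub_ne_zero hde) (neg_sub_ne_zero haf) (neg_sub_ne_zero hbf) (neg_sub_ne_zero hcf)
    (neg_sub_ne_zero hdf)
  rw [involutionDet_rotate e f a b c d] at h2
  rw [← neg_sub a e, ← neg_sub b e, ← neg_sub c e, ← neg_sub d e, ← neg_sub a f, ← neg_sub b f,
    ← neg_sub c f, ← neg_sub d f] at h2
  have key : (a - b) ^ 2 * (involutionDet a b c e d f * involutionDet a b c f d e)
        * ((c - e) * (c - f) * (d - e) * (d - f))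
      - (c - d) ^ 2 * (involutionDet c d a e b f * involutionDet c d a f b e)
        * ((a - e) * (a - f) * (b - e) * (b - f))
      + (e - f) ^ 2 * (involutionDet e f a c b d * involutionDet e f a d b c)
        * ((a - c) * (a - d) * (b - c) * (b - d)) = 0 := by
    unfold involutionDet; ring
  generalize involutionDet a b c d e f = I0 at *
  generalize involutionDet a b c e d f = I1 at *
  generalize involutionDet a b c f d e = I2 at *
  generalize involutionDet c d a e b f = I3 at *
  generalize involutionDet c d a f b e = I4 at *
  generalize involutionDet e f a c b d = I5 at *
  generalize involutionDet e f a d b c = I6 at *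
  generalize a - b = ab at *
  generalize a - c = ac at *
  generalize a - d = ad at *
  generalize a - e = ae at *
  generalize a - f = af at *
  generalize b - c = bc at *
  generalize b - d = bd at *
  generalize b - e = be at *
  generalize b - f = bf at *
  generalize c - d = cd at *
  generalize c - e = ce at *
  generalize c - f = cf at *
  generalize d - e = de at *
  generalize d - f = df at *
  generalize e - f = ef at *
  rw [show ∀ x y z u v w : F, x + y + z + u + v + w = x + y + (z + u) + (v + w) by intros; ring,
    h0, h1, h2]
  field_simp
  linear_combination 2 * I0 * key

theorem covariant_quintic_esymm_three {P : F[X]} {a b c d e : F}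
    (hP : P = (X - C a) * (X - C b) * (X - C c) * (X - C d) * (X - C e))
    (hab : a - b ≠ 0) (hac : a - c ≠ 0) (had : a - d ≠ 0) (hae : a - e ≠ 0) (hbc : b - c ≠ 0)
    (hbd : b - d ≠ 0) (hbe : b - e ≠ 0) (hcd : c - d ≠ 0) (hce : c - e ≠ 0) (hde : d - e ≠ 0) :
    covariant quinticCovariant P a * covariant quinticCovariant P b * covariant quinticCovariant P c
      + covariant quinticCovariant P a * covariant quinticCovariant P b
        * covariant quinticCovariant P d
      + covariant quinticCovariant P a * covariant quinticCovariant P b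
        * covariant quinticCovariant P e
      + covariant quinticCovariant P a * covariant quinticCovariant P c
        * covariant quinticCovariant P d
      + covariant quinticCovariant P a * covariant quinticCovariant P c
        * covariant quinticCovariant P e
      + covariant quinticCovariant P a * covariant quinticCovariant P d
        * covariant quinticCovariant P e
      + covariant quinticCovariant P b * covariant quinticCovariant P c
        * covariant quinticCovariant P d
      + covariant quinticCovariant P b * covariant quinticCovariant P c
        * covariant quinticCovariant P e
      + covariant quinticCovariant P b * covariant quinticCovariant P d
        * covariant quinticCovariant P e
      + covariant quinticCovariant P c * covariant quinticCovariant P d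
        * covariant quinticCovariant P e = 0 := by
  have hs := covariant_quintic_sum hP hab hac had hae hbc hbd hbe hcd hce hde
  have h0 := covariant_quintic_add (P := P) (a := a) (b := b) (c := c) (d := d) (e := e)
    hP hab hac had hae hbc hbd hbe
  have h1 := covariant_quintic_add (P := P) (a := a) (b := c) (c := b) (d := d) (e := e)
    (by rw [hP]; ring) hac hab had hae (neg_sub_ne_zero hbc) hcd hce
  rw [← neg_sub b c] at h1
  have h2 := covariant_quintic_add (P := P) (a := b) (b := c) (c := a) (d := d) (e := e)
    (by rw [hP]; ring) hbc (neg_sub_ne_zero hab) hbd hbe (neg_sub_ne_zero hac) hcd hce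
  rw [← neg_sub a b, ← neg_sub a c] at h2
  have h3 := covariant_quintic_eq (P := P) (r := d) (a := a) (b := b) (c := c) (d := e)
    (by rw [hP]; ring)
  rw [involutionDet_swap d d a b c e, involutionDet_swap d d a c b e,
    involutionDet_rotate d d a e b c, involutionDet_rotate a e b c d d] at h3
  rw [← neg_sub a d, ← neg_sub b d, ← neg_sub c d] at h3
  have h4 := covariant_quintic_eq (P := P) (r := e) (a := a) (b := b) (c := c) (d := d)
    (by rw [hP]; ring)
  rw [involutionDet_swap e e a b c d, involutionDet_swap e e a c b d,
    involutionDet_rotate e e a d b c, involutionDet_rotate a d b c e e] at h4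
  rw [← neg_sub a e, ← neg_sub b e, ← neg_sub c e, ← neg_sub d e] at h4
  have h5 := covariant_quintic_add (P := P) (a := d) (b := e) (c := a) (d := b) (e := c)
    (by rw [hP]; ring) hde (neg_sub_ne_zero had) (neg_sub_ne_zero hbd) (neg_sub_ne_zero hcd)
    (neg_sub_ne_zero hae) (neg_sub_ne_zero hbe) (neg_sub_ne_zero hce)
  rw [involutionDet_swap d e a a b c, involutionDet_rotate a a d e b c,
    involutionDet_rotate d e b c a a, involutionDet_swap d e b b a c,
    involutionDet_rotate b b d e a c, involutionDet_rotate d e a c b b,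
    involutionDet_swap d e c c a b, involutionDet_rotate c c d e a b,
    involutionDet_rotate d e a b c c] at h5
  rw [← neg_sub a d, ← neg_sub b d, ← neg_sub c d, ← neg_sub a e, ← neg_sub b e,
    ← neg_sub c e] at h5
  clear hP
  generalize covariant quinticCovariant P a = u0 at *
  generalize covariant quinticCovariant P b = u1 at *
  generalize covariant quinticCovariant P c = u2 at *
  generalize covariant quinticCovariant P d = u3 at *
  generalize covariant quinticCovariant P e = u4 at *
  generalize involutionDet a b c c d e = I0 at *
  generalize involutionDet a b d d c e = I1 at *
  generalize involutionDet a b e e c d = I2 at *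
  generalize involutionDet a c b b d e = I3 at *
  generalize involutionDet a c d d b e = I4 at *
  generalize involutionDet a c e e b d = I5 at *
  generalize involutionDet b c a a d e = I6 at *
  generalize involutionDet b c d d a e = I7 at *
  generalize involutionDet b c e e a d = I8 at *
  generalize a - b = ab at *
  generalize a - c = ac at *
  generalize a - d = ad at *
  generalize a - e = ae at *
  generalize b - c = bc at *
  generalize b - d = bd at *
  generalize b - e = be at *
  generalize c - d = cd at *
  generalize c - e = ce at *
  generalize d - e = de at *
  -- Both products have the same nine determinants over the squared differences between `{a, b, c}`
  -- and `{d, e}`, with opposite signs. No relation among these quantities is needed, hence the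
  -- independent symbols.
  have key : (u0 + u1) * (u0 + u2) * (u1 + u2) + u3 * u4 * (u3 + u4) = 0 := by
    rw [h0, h1, h2, h5, h3, h4]
    field_simp
    ring
  linear_combination (u0 * u1 + u0 * u2 + u1 * u2 + u3 * u4) * hs - key

/-- Of the fifteen partitions into pairs, nine have a pair inside `{a, b, c}`; the remaining root of
that triple then meets one of `{d, e, f}`, so the same nine have a pair inside `{d, e, f}`. -/
theorem covariant_sextic_esymm_three {P : F[X]} {a b c d e f : F}
    (hP : P = (X - C a) * (X - C b) * (X - C c) * (X - C d) * (X - C e) * (X - C f))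
    (hab : a - b ≠ 0) (hac : a - c ≠ 0) (had : a - d ≠ 0) (hae : a - e ≠ 0) (haf : a - f ≠ 0)
    (hbc : b - c ≠ 0) (hbd : b - d ≠ 0) (hbe : b - e ≠ 0) (hbf : b - f ≠ 0) (hcd : c - d ≠ 0)
    (hce : c - e ≠ 0) (hcf : c - f ≠ 0) (hde : d - e ≠ 0) (hdf : d - f ≠ 0) (hef : e - f ≠ 0) :
    covariant sexticCovariant P a * covariant sexticCovariant P b * covariant sexticCovariant P c
      + covariant sexticCovariant P a * covariant sexticCovariant P b * covariant sexticCovariant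
      P d
      + covariant sexticCovariant P a * covariant sexticCovariant P b * covariant sexticCovariant
      P e
      + covariant sexticCovariant P a * covariant sexticCovariant P b * covariant sexticCovariant
      P f
      + covariant sexticCovariant P a * covariant sexticCovariant P c * covariant sexticCovariant
      P d
      + covariant sexticCovariant P a * covariant sexticCovariant P c * covariant sexticCovariant
      P e
      + covariant sexticCovariant P a * covariant sexticCovariant P c * covariant sexticCovariant
      P f
      + covariant sexticCovariant P a * covariant sexticCovariant P d * covariant sexticCovariant
      P e
      + covariant sexticCovariant P a * covariant sexticCovariant P d * covariant sexticCovariant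
      P f
      + covariant sexticCovariant P a * covariant sexticCovariant P e * covariant sexticCovariant
      P f
      + covariant sexticCovariant P b * covariant sexticCovariant P c * covariant sexticCovariant
      P d
      + covariant sexticCovariant P b * covariant sexticCovariant P c * covariant sexticCovariant
      P e
      + covariant sexticCovariant P b * covariant sexticCovariant P c * covariant sexticCovariant
      P f
      + covariant sexticCovariant P b * covariant sexticCovariant P d * covariant sexticCovariant
      P e
      + covariant sexticCovariant P b * covariant sexticCovariant P d * covariant sexticCovariant
      P f
      + covariant sexticCovariant P b * covariant sexticCovariant P e * covariant sexticCovariant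
      P f
      + covariant sexticCovariant P c * covariant sexticCovariant P d * covariant sexticCovariant
      P e
      + covariant sexticCovariant P c * covariant sexticCovariant P d * covariant sexticCovariant
      P f
      + covariant sexticCovariant P c * covariant sexticCovariant P e * covariant sexticCovariant
      P f
      + covariant sexticCovariant P d * covariant sexticCovariant P e * covariant sexticCovariant
      P f = 0 := by
  have hs := covariant_sextic_sum hP hab hac had hae haf hbc hbd hbe hbf hcd hce hcf hde hdf hef
  have h0 := covariant_sextic_add (P := P) (a := a) (b := b) (c := c) (d := d) (e := e) (f := f)
    hP hab hac had hae haf hbc hbd hbe hbf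
  have h1 := covariant_sextic_add (P := P) (a := a) (b := c) (c := b) (d := d) (e := e) (f := f)
    (by rw [hP]; ring) hac hab had hae haf (neg_sub_ne_zero hbc) hcd hce hcf
  rw [← neg_sub b c] at h1
  have h2 := covariant_sextic_add (P := P) (a := b) (b := c) (c := a) (d := d) (e := e) (f := f)
    (by rw [hP]; ring) hbc (neg_sub_ne_zero hab) hbd hbe hbf (neg_sub_ne_zero hac) hcd hce hcf
  rw [← neg_sub a b, ← neg_sub a c] at h2
  have h3 := covariant_sextic_add (P := P) (a := d) (b := e) (c := a) (d := b) (e := c) (f := f)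
    (by rw [hP]; ring) hde (neg_sub_ne_zero had) (neg_sub_ne_zero hbd) (neg_sub_ne_zero hcd) hdf
    (neg_sub_ne_zero hae) (neg_sub_ne_zero hbe) (neg_sub_ne_zero hce) hef
  rw [involutionDet_rotate d e a b c f, involutionDet_rotate d e a c b f,
    involutionDet_swap d e a f b c, involutionDet_rotate a f d e b c,
    involutionDet_rotate d e b c a f] at h3
  rw [← neg_sub a d, ← neg_sub b d, ← neg_sub c d, ← neg_sub a e, ← neg_sub b e,
    ← neg_sub c e] at h3
  have h4 := covariant_sextic_add (P := P) (a := d) (b := f) (c := a) (d := b) (e := c) (f := e)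
    (by rw [hP]; ring) hdf (neg_sub_ne_zero had) (neg_sub_ne_zero hbd) (neg_sub_ne_zero hcd) hde
    (neg_sub_ne_zero haf) (neg_sub_ne_zero hbf) (neg_sub_ne_zero hcf) (neg_sub_ne_zero hef)
  rw [involutionDet_rotate d f a b c e, involutionDet_rotate d f a c b e,
    involutionDet_swap d f a e b c, involutionDet_rotate a e d f b c,
    involutionDet_rotate d f b c a e] at h4
  rw [← neg_sub a d, ← neg_sub b d, ← neg_sub c d, ← neg_sub a f, ← neg_sub b f, ← neg_sub c f,
    ← neg_sub e f] at h4
  have h5 := covariant_sextic_add (P := P) (a := e) (b := f) (c := a) (d := b) (e := c) (f := d)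
    (by rw [hP]; ring) hef (neg_sub_ne_zero hae) (neg_sub_ne_zero hbe) (neg_sub_ne_zero hce)
    (neg_sub_ne_zero hde) (neg_sub_ne_zero haf) (neg_sub_ne_zero hbf) (neg_sub_ne_zero hcf)
    (neg_sub_ne_zero hdf)
  rw [involutionDet_rotate e f a b c d, involutionDet_rotate e f a c b d,
    involutionDet_swap e f a d b c, involutionDet_rotate a d e f b c,
    involutionDet_rotate e f b c a d] at h5
  rw [← neg_sub a e, ← neg_sub b e, ← neg_sub c e, ← neg_sub d e, ← neg_sub a f, ← neg_sub b f,
    ← neg_sub c f, ← neg_sub d f] at h5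
  clear hP
  generalize covariant sexticCovariant P a = u0 at *
  generalize covariant sexticCovariant P b = u1 at *
  generalize covariant sexticCovariant P c = u2 at *
  generalize covariant sexticCovariant P d = u3 at *
  generalize covariant sexticCovariant P e = u4 at *
  generalize covariant sexticCovariant P f = u5 at *
  generalize involutionDet a b c d e f = I0 at *
  generalize involutionDet a b c e d f = I1 at *
  generalize involutionDet a b c f d e = I2 at *
  generalize involutionDet a c b d e f = I3 at *
  generalize involutionDet a c b e d f = I4 at *
  generalize involutionDet a c b f d e = I5 at *
  generalize involutionDet b c a d e f = I6 at *
  generalize involutionDet b c a e d f = I7 at *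
  generalize involutionDet b c a f d e = I8 at *
  generalize a - b = ab at *
  generalize a - c = ac at *
  generalize a - d = ad at *
  generalize a - e = ae at *
  generalize a - f = af at *
  generalize b - c = bc at *
  generalize b - d = bd at *
  generalize b - e = be at *
  generalize b - f = bf at *
  generalize c - d = cd at *
  generalize c - e = ce at *
  generalize c - f = cf at *
  generalize d - e = de at *
  generalize d - f = df at *
  generalize e - f = ef at *
  have key : (u0 + u1) * (u0 + u2) * (u1 + u2) + (u3 + u4) * (u3 + u5) * (u4 + u5) = 0 := by
    rw [h0, h1, h2, h3, h4, h5]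
    field_simp
    ring
  -- For a triple, `(u + v)(u + w)(v + w) = e_1 e_2 - e_3`; the two triples have opposite `e_1`.
  linear_combination (u0 * u1 + u0 * u2 + u1 * u2 + u3 * u4 + u3 * u5 + u4 * u5) * hs - key

end Identities

/-! ### Generic elements have distinct covariant values -/

section Generic

open Polynomial

/-- In a basis of `L`, conjugate vectors are the image of `K^n` under the embeddings matrix,
invertible because the discriminant of a separable extension is nonzero. As `K` is infinite, a
polynomial vanishing on that image is zero. -/
theorem exists_eval_embeddings_ne_zero {K L Ω ι : Type*} [Field K] [Infinite K] [Field L]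
    [Field Ω] [Algebra K L] [Algebra K Ω] [IsAlgClosed Ω] [FiniteDimensional K L]
    [Algebra.IsSeparable K L] [Fintype ι] [DecidableEq ι] (e : ι ≃ (L →ₐ[K] Ω))
    {p : MvPolynomial ι Ω} (hp : p ≠ 0) :
    ∃ x : L, MvPolynomial.eval (fun i => e i x) p ≠ 0 := by
  by_contra! h
  have hcard : Fintype.card ι = Module.finrank K L := by
    rw [← AlgHom.card K L Ω, Fintype.card_congr e]
  let b : Module.Basis ι K L :=
    (Module.finBasis K L).reindex (Fintype.equivOfCardEq (by simp [hcard]))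
  have hdet : (Algebra.embeddingsMatrixReindex K Ω b e).det ≠ 0 := fun h0 => by
    have := Algebra.discr_eq_det_embeddingsMatrixReindex_pow_two K Ω b e
    rw [h0, zero_pow two_ne_zero, map_eq_zero] at this
    exact Algebra.discr_not_zero_of_basis K b this
  set M := (Algebra.embeddingsMatrixReindex K Ω b e).transpose with hM
  have hMdet : IsUnit M.det := by
    rw [hM, Matrix.det_transpose]; exact hdet.isUnit
  let G : MvPolynomial ι Ω :=
    MvPolynomial.bind₁ (fun i => ∑ k, MvPolynomial.C (M i k) * MvPolynomial.X k) p
  have hG : ∀ t : ι → Ω, MvPolynomial.eval t G = MvPolynomial.eval (M.mulVec t) p := fun t => by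
    simp only [G]
    rw [← MvPolynomial.coe_aeval_eq_eval, ← MvPolynomial.coe_aeval_eq_eval, RingHom.coe_coe,
      RingHom.coe_coe, MvPolynomial.aeval_bind₁]
    congr 2
    ext i
    simp [Matrix.mulVec, dotProduct]
  have hG0 : G = 0 := by
    refine MvPolynomial.funext_set (fun _ => Set.range (algebraMap K Ω))
      (fun _ => Set.infinite_range_of_injective (algebraMap K Ω).injective) fun t ht => ?_
    choose s hs using fun i => ht i trivial
    rw [hG, map_zero, ← h (∑ k, s k • b k)]
    congr 2
    ext i
    simp [Matrix.mulVec, dotProduct, hM, Algebra.embeddingsMatrixReindex,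
      Algebra.embeddingsMatrix, ← hs, Algebra.smul_def, mul_comm]
  have : Infinite Ω := Infinite.of_injective _ (algebraMap K Ω).injective
  refine hp (MvPolynomial.funext fun v => ?_)
  have := hG (M⁻¹.mulVec v)
  rw [Matrix.mulVec_mulVec, Matrix.mul_nonsing_inv _ hMdet, Matrix.one_mulVec, hG0] at this
  rw [← this]; simp

theorem minpoly_map_eq_prod_embeddings {K L Ω ι : Type*} [Field K] [Field L]
    [Field Ω] [Algebra K L] [Algebra K Ω] [FiniteDimensional K L] [Fintype ι]
    (hcard : Fintype.card ι = Module.finrank K L) (e : ι → (L →ₐ[K] Ω)) {y : L}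
    (hy : Function.Injective fun i => e i y) :
    (minpoly K y).map (algebraMap K Ω) = ∏ i, (X - C (e i y)) ∧
      (minpoly K y).natDegree = Module.finrank K L := by
  have hint : IsIntegral K y := Algebra.IsIntegral.isIntegral y
  have hdvd : ∏ i, (X - C (e i y)) ∣ (minpoly K y).map (algebraMap K Ω) := by
    refine Fintype.prod_dvd_of_coprime (pairwise_coprime_X_sub_C hy) fun i => ?_
    rw [dvd_iff_isRoot, IsRoot, eval_map_algebraMap]
    rw [aeval_algHom_apply, minpoly.aeval, map_zero]
  have hdeg : (∏ i, (X - C (e i y))).natDegree = Module.finrank K L := by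
    simp [hcard]
  have hle : (minpoly K y).natDegree ≤ Module.finrank K L := minpoly.natDegree_le y
  have hmon := (minpoly.monic hint).map (algebraMap K Ω)
  have heq := eq_of_monic_of_dvd_of_natDegree_le (monic_prod_X_sub_C _ _) hmon hdvd
    (by rw [natDegree_map, hdeg]; exact hle)
  refine ⟨heq, ?_⟩
  rw [← hdeg, ← heq, natDegree_map]

/-- The polynomial in indeterminates `t` whose nonvanishing separates the values of
`covariant q` at the roots `t i` and `t j` of `∏ (X - t k)`. -/
noncomputable def covariantDiff {R ι : Type*} [CommRing R] [Fintype ι]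
    (q : MvPolynomial (Fin 4) ℤ) (t : ι → R) (i j : ι) : R :=
  covariantNum q (∏ k, (X - C (t k))) (t i) * (hasseDeriv 1 (∏ k, (X - C (t k)))).eval (t j)
    - covariantNum q (∏ k, (X - C (t k))) (t j) * (hasseDeriv 1 (∏ k, (X - C (t k)))).eval (t i)

theorem map_covariantDiff {R S ι : Type*} [CommRing R] [CommRing S] [Fintype ι] (f : R →+* S)
    (q : MvPolynomial (Fin 4) ℤ) (t : ι → R) (i j : ι) :
    f (covariantDiff q t i j) = covariantDiff q (fun k => f (t k)) i j := by
  have h : (∏ k, (X - C (t k))).map f = ∏ k, (X - C (f (t k))) := by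
    simp [Polynomial.map_prod]
  simp only [covariantDiff, map_sub, map_mul, map_covariantNum, ← eval_hasseDeriv_map, h]

variable {F : Type*} [Field F]

theorem eval_hasseDeriv_one_prod_ne_zero {ι : Type*} [Fintype ι] [DecidableEq ι] {t : ι → F}
    {i : ι} (h : ∀ k ≠ i, t i ≠ t k) : (hasseDeriv 1 (∏ k, (X - C (t k)))).eval (t i) ≠ 0 := by
  rw [← Finset.mul_prod_erase _ _ (Finset.mem_univ i), hasseDeriv_one, derivative_mul]
  simp only [derivative_sub, derivative_X, derivative_C, eval_add, eval_mul, eval_sub, eval_X,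
    eval_C, sub_self, zero_mul, add_zero, sub_zero, one_mul, eval_prod]
  exact Finset.prod_ne_zero_iff.2 fun k hk => sub_ne_zero.2 (h k (Finset.ne_of_mem_erase hk))

theorem eval_hasseDeriv_prod_of_double_root {ι : Type*} [Fintype ι] [DecidableEq ι] {t : ι → F}
    {i j : ι} (hij : i ≠ j) (ht : t i = t j) (h : ∀ k, k ≠ i → k ≠ j → t i ≠ t k) :
    (hasseDeriv 1 (∏ k, (X - C (t k)))).eval (t i) = 0 ∧
    (hasseDeriv 2 (∏ k, (X - C (t k)))).eval (t i) ≠ 0 := by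
  rw [← Finset.mul_prod_erase _ _ (Finset.mem_univ i), ← Finset.mul_prod_erase _ _
    (Finset.mem_erase.2 ⟨hij.symm, Finset.mem_univ j⟩), ← ht, ← mul_assoc, ← taylor_coeff,
    ← taylor_coeff]
  have h2 : taylor (t i) ((X - C (t i)) * (X - C (t i))) = X ^ 2 := by
    simp [taylor_mul]; ring
  rw [taylor_mul, h2, coeff_X_pow_mul', coeff_X_pow_mul']
  simp only [Nat.not_ofNat_le_one, if_false, le_refl, if_true, tsub_self, taylor_coeff_zero,
    eval_prod, eval_sub, eval_X, eval_C, true_and]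
  refine Finset.prod_ne_zero_iff.2 fun k hk => sub_ne_zero.2 ?_
  simp only [Finset.mem_erase] at hk
  exact h k hk.2.1 hk.1

/-- When `x_j` collides with a third root `x_k`, the value at `x_j` acquires a pole while the value
at `x_i` stays finite, so the two cannot agree identically. Cross-multiplied, the difference
survives this specialization. -/
theorem covariantDiff_X_ne_zero [Infinite F] {ι : Type*} [Fintype ι] [DecidableEq ι]
    (hι : 2 < Fintype.card ι) {q : MvPolynomial (Fin 4) ℤ}
    (hq : ∀ c : Fin 4 → F, c 0 = 0 → c 1 ≠ 0 → MvPolynomial.aeval c q ≠ 0) {i j : ι}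
    (hij : i ≠ j) :
    covariantDiff q (MvPolynomial.X : ι → MvPolynomial ι F) i j ≠ 0 := by
  obtain ⟨k, hk⟩ : ∃ k, k ∉ ({i, j} : Finset ι) := by
    by_contra! h
    have := (Finset.card_le_card (fun x _ => h x : Finset.univ ⊆ ({i, j} : Finset ι))).trans
      Finset.card_le_two
    rw [Finset.card_univ] at this
    omega
  simp only [Finset.mem_insert, Finset.mem_singleton, not_or] at hk
  obtain ⟨s⟩ : Nonempty (ι ↪ F) := ⟨(Fintype.equivFin ι).toEmbedding.trans
    (Fin.valEmbedding.trans (Infinite.natEmbedding F))⟩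
  -- Distinct points, except that `t k = t j` is a double root.
  let t : ι → F := Function.update s k (s j)
  have htk : t k = s j := Function.update_self ..
  have ht : ∀ l ≠ k, t l = s l := fun l hl => Function.update_of_ne hl ..
  have hi := eval_hasseDeriv_one_prod_ne_zero (t := t) (i := i) fun l hl => by
    rw [ht i (Ne.symm hk.1)]
    by_cases h : l = k
    · rw [h, htk]; exact s.injective.ne hij
    · rw [ht l h]; exact s.injective.ne hl.symm
  obtain ⟨h1, h2⟩ := eval_hasseDeriv_prod_of_double_root (t := t) (i := j) (j := k)
    (Ne.symm hk.2) (by rw [htk, ht j (Ne.symm hk.2)]) fun l hl hl' => by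
      rw [ht l hl', ht j (Ne.symm hk.2)]; exact s.injective.ne hl.symm
  intro h0
  have := map_covariantDiff (MvPolynomial.eval t) q MvPolynomial.X i j
  rw [h0, map_zero] at this
  simp only [MvPolynomial.eval_X, covariantDiff, h1, mul_zero, zero_sub] at this
  exact mul_ne_zero (hq (fun k => (hasseDeriv (k + 1) (∏ k, (X - C (t k)))).eval (t j)) h1 h2) hi
    (neg_eq_zero.1 this.symm)

theorem exists_injective_covariant {K L Ω ι : Type*} [Field K] [Infinite K] [Field L]
    [Field Ω] [Algebra K L] [Algebra K Ω] [IsAlgClosed Ω] [FiniteDimensional K L]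
    [Algebra.IsSeparable K L] [Fintype ι] [DecidableEq ι] (e : ι ≃ (L →ₐ[K] Ω))
    (hι : 2 < Fintype.card ι) {q : MvPolynomial (Fin 4) ℤ}
    (hq : ∀ c : Fin 4 → Ω, c 0 = 0 → c 1 ≠ 0 → MvPolynomial.aeval c q ≠ 0) :
    ∃ x y : L, (Function.Injective fun i => e i x) ∧ (Function.Injective fun i => e i y) ∧
      ∀ i, e i y = covariant q (∏ k, (X - C (e k x))) (e i x) := by
  have : Infinite Ω := Infinite.of_injective _ (algebraMap K Ω).injective
  -- The factors `X i - X j` make the conjugates of `x` distinct, so that `P` is its minimal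
  -- polynomial and `P'` is nonzero at each root.
  have hp : ∏ ij ∈ (Finset.univ : Finset ι).offDiag,
      (covariantDiff q (MvPolynomial.X : ι → MvPolynomial ι Ω) ij.1 ij.2
        * (MvPolynomial.X ij.1 - MvPolynomial.X ij.2)) ≠ 0 := by
    refine Finset.prod_ne_zero_iff.2 fun ij hij => mul_ne_zero ?_ ?_
    · exact covariantDiff_X_ne_zero hι hq (Finset.mem_offDiag.1 hij).2.2
    · exact sub_ne_zero.2 ((MvPolynomial.X_injective).ne (Finset.mem_offDiag.1 hij).2.2)
  obtain ⟨x, hx⟩ := exists_eval_embeddings_ne_zero e hp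
  rw [map_prod, Finset.prod_ne_zero_iff] at hx
  have hne : ∀ i j, i ≠ j → covariantDiff q (fun k => e k x) i j ≠ 0 ∧ e i x ≠ e j x :=
    fun i j hij => by
      have := hx (i, j) (by simp [hij])
      rw [map_mul, map_covariantDiff, map_sub] at this
      simp only [MvPolynomial.eval_X] at this
      exact ⟨left_ne_zero_of_mul this, sub_ne_zero.1 (right_ne_zero_of_mul this)⟩
  have hxinj : Function.Injective fun i => e i x := fun i j h => by
    by_contra hij
    exact (hne i j hij).2 h
  have hcard : Fintype.card ι = Module.finrank K L := by
    rw [← AlgHom.card K L Ω, Fintype.card_congr e]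
  obtain ⟨hmin, -⟩ := minpoly_map_eq_prod_embeddings hcard e hxinj
  have hcov : ∀ i, e i (covariant q ((minpoly K x).map (algebraMap K L)) x)
      = covariant q (∏ k, (X - C (e k x))) (e i x) := fun i => by
    have := map_covariant (e i : L →+* Ω) q ((minpoly K x).map (algebraMap K L)) x
    rw [Polynomial.map_map, AlgHom.comp_algebraMap, hmin] at this
    exact this
  refine ⟨x, covariant q ((minpoly K x).map (algebraMap K L)) x, hxinj, fun i j h => ?_, hcov⟩
  by_contra hij
  simp only [hcov] at h
  simp only [covariant] at h
  have hder := fun l => eval_hasseDeriv_one_prod_ne_zero (t := fun k => e k x) (i := l)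
    fun k hk => hxinj.ne hk.symm
  rw [div_eq_div_iff (hder i) (hder j)] at h
  exact (hne i j hij).1 (sub_eq_zero.2 h)

end Generic

/-! ### From symmetric functions to coefficients, and the theorem -/

section Reduction

open Polynomial

variable {F : Type*} [Field F]

theorem coeff_prod_X_sub_C_five (a b c d e : F) :
    ((X - C a) * (X - C b) * (X - C c) * (X - C d) * (X - C e)).coeff 4 = -(a + b + c + d + e) ∧
    ((X - C a) * (X - C b) * (X - C c) * (X - C d) * (X - C e)).coeff 2 =
      -(a * b * c + a * b * d + a * b * e + a * c * d + a * c * e + a * d * e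
        + b * c * d + b * c * e + b * d * e + c * d * e) := by
  have h : (X - C a) * (X - C b) * (X - C c) * (X - C d) * (X - C e) =
      X ^ 5 - C (a + b + c + d + e) * X ^ 4
      + C (a * b + a * c + a * d + a * e + b * c + b * d + b * e + c * d + c * e + d * e) * X ^ 3
      - C (a * b * c + a * b * d + a * b * e + a * c * d + a * c * e + a * d * e
        + b * c * d + b * c * e + b * d * e + c * d * e) * X ^ 2
      + C (a * b * c * d + a * b * c * e + a * b * d * e + a * c * d * e + b * c * d * e) * X ^ 1
      - C (a * b * c * d * e) * X ^ 0 := by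
    simp only [C_add, C_mul]
    ring
  rw [h]
  simp only [coeff_add, coeff_sub, coeff_C_mul, coeff_X_pow]
  norm_num

theorem coeff_prod_X_sub_C_six (a b c d e f : F) :
    ((X - C a) * (X - C b) * (X - C c) * (X - C d) * (X - C e) * (X - C f)).coeff 5 =
      -(a + b + c + d + e + f) ∧
    ((X - C a) * (X - C b) * (X - C c) * (X - C d) * (X - C e) * (X - C f)).coeff 3 =
      -(a * b * c + a * b * d + a * b * e + a * b * f + a * c * d + a * c * e + a * c * f
        + a * d * e + a * d * f + a * e * f + b * c * d + b * c * e + b * c * f + b * d * e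
        + b * d * f + b * e * f + c * d * e + c * d * f + c * e * f + d * e * f) := by
  have h : (X - C a) * (X - C b) * (X - C c) * (X - C d) * (X - C e) =
      X ^ 5 - C (a + b + c + d + e) * X ^ 4
      + C (a * b + a * c + a * d + a * e + b * c + b * d + b * e + c * d + c * e + d * e) * X ^ 3
      - C (a * b * c + a * b * d + a * b * e + a * c * d + a * c * e + a * d * e
        + b * c * d + b * c * e + b * d * e + c * d * e) * X ^ 2
      + C (a * b * c * d + a * b * c * e + a * b * d * e + a * c * d * e + b * c * d * e) * X ^ 1
      - C (a * b * c * d * e) * X ^ 0 := by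
    simp only [C_add, C_mul]
    ring
  rw [h, mul_sub, coeff_sub, coeff_sub, coeff_mul_X, coeff_mul_X, coeff_mul_C, coeff_mul_C]
  simp only [coeff_add, coeff_sub, coeff_C_mul, coeff_X_pow]
  norm_num
  constructor <;> ring

theorem coeff_prod_covariant_quintic {x y : Fin 5 → F} (hx : Function.Injective x)
    (hy : ∀ i, y i = covariant quinticCovariant (∏ k, (X - C (x k))) (x i)) :
    (∏ i, (X - C (y i))).coeff 4 = 0 ∧ (∏ i, (X - C (y i))).coeff 2 = 0 := by
  have hsub : ∀ i j, i ≠ j → x i - x j ≠ 0 := fun i j hij => sub_ne_zero.2 (hx.ne hij)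
  have hP := Fin.prod_univ_five fun k => X - C (x k)
  generalize ∏ k, (X - C (x k)) = P at hP hy
  have hsum := covariant_quintic_sum hP
    (hsub _ _ (by decide)) (hsub _ _ (by decide)) (hsub _ _ (by decide)) (hsub _ _ (by decide))
    (hsub _ _ (by decide)) (hsub _ _ (by decide)) (hsub _ _ (by decide)) (hsub _ _ (by decide))
    (hsub _ _ (by decide)) (hsub _ _ (by decide))
  have hesymm := covariant_quintic_esymm_three hP
    (hsub _ _ (by decide)) (hsub _ _ (by decide)) (hsub _ _ (by decide)) (hsub _ _ (by decide))
    (hsub _ _ (by decide)) (hsub _ _ (by decide)) (hsub _ _ (by decide)) (hsub _ _ (by decide))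
    (hsub _ _ (by decide)) (hsub _ _ (by decide))
  simp only [← hy] at hsum hesymm
  rw [Fin.prod_univ_five]
  obtain ⟨h4, h2⟩ := coeff_prod_X_sub_C_five (y 0) (y 1) (y 2) (y 3) (y 4)
  rw [hsum, neg_zero] at h4
  rw [hesymm, neg_zero] at h2
  exact ⟨h4, h2⟩

theorem coeff_prod_covariant_sextic {x y : Fin 6 → F} (hx : Function.Injective x)
    (hy : ∀ i, y i = covariant sexticCovariant (∏ k, (X - C (x k))) (x i)) :
    (∏ i, (X - C (y i))).coeff 5 = 0 ∧ (∏ i, (X - C (y i))).coeff 3 = 0 := by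
  have hsub : ∀ i j, i ≠ j → x i - x j ≠ 0 := fun i j hij => sub_ne_zero.2 (hx.ne hij)
  have hP := Fin.prod_univ_six fun k => X - C (x k)
  generalize ∏ k, (X - C (x k)) = P at hP hy
  have hsum := covariant_sextic_sum hP
    (hsub _ _ (by decide)) (hsub _ _ (by decide)) (hsub _ _ (by decide)) (hsub _ _ (by decide))
    (hsub _ _ (by decide)) (hsub _ _ (by decide)) (hsub _ _ (by decide)) (hsub _ _ (by decide))
    (hsub _ _ (by decide)) (hsub _ _ (by decide)) (hsub _ _ (by decide)) (hsub _ _ (by decide))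
    (hsub _ _ (by decide)) (hsub _ _ (by decide)) (hsub _ _ (by decide))
  have hesymm := covariant_sextic_esymm_three hP
    (hsub _ _ (by decide)) (hsub _ _ (by decide)) (hsub _ _ (by decide)) (hsub _ _ (by decide))
    (hsub _ _ (by decide)) (hsub _ _ (by decide)) (hsub _ _ (by decide)) (hsub _ _ (by decide))
    (hsub _ _ (by decide)) (hsub _ _ (by decide)) (hsub _ _ (by decide)) (hsub _ _ (by decide))
    (hsub _ _ (by decide)) (hsub _ _ (by decide)) (hsub _ _ (by decide))
  simp only [← hy] at hsum hesymm
  rw [Fin.prod_univ_six]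
  obtain ⟨h5, h3⟩ := coeff_prod_X_sub_C_six (y 0) (y 1) (y 2) (y 3) (y 4) (y 5)
  rw [hsum, neg_zero] at h5
  rw [hesymm, neg_zero] at h3
  exact ⟨h5, h3⟩

end Reduction

theorem exists_adjoin_eq_top_minpoly_quintic (K : Type*) [Field K] [Infinite K]
    (L : Type*) [Field L] [Algebra K L] [Algebra.IsSeparable K L]
    (hn : Module.finrank K L = 5) :
    ∃ x : L, IntermediateField.adjoin K {x} = ⊤ ∧
      (minpoly K x).Monic ∧ (minpoly K x).natDegree = 5 ∧
      (minpoly K x).coeff 4 = 0 ∧ (minpoly K x).coeff 2 = 0 := by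
  -- `Module.finrank` is `0` in the infinite case, so a positive value forces finiteness.
  have : FiniteDimensional K L := Module.finite_of_finrank_pos (by omega)
  obtain ⟨e⟩ : Nonempty (Fin 5 ≃ (L →ₐ[K] AlgebraicClosure L)) :=
    ⟨Fintype.equivOfCardEq (by rw [AlgHom.card, hn, Fintype.card_fin])⟩
  obtain ⟨x, y, hx, hy, hxy⟩ := exists_injective_covariant e (by simp)
    (q := quinticCovariant) fun c h0 h1 => by simp [quinticCovariant, h0, h1]
  obtain ⟨hmin, hdeg⟩ := minpoly_map_eq_prod_embeddings (by simp [hn]) e hy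
  obtain ⟨h4, h2⟩ := coeff_prod_covariant_quintic hx (y := fun i => e i y) hxy
  rw [← hmin, Polynomial.coeff_map, map_eq_zero] at h4 h2
  exact ⟨y, (Field.primitive_element_iff_minpoly_natDegree_eq K y).2 hdeg,
    minpoly.monic (Algebra.IsIntegral.isIntegral y), hdeg.trans hn, h4, h2⟩

theorem exists_adjoin_eq_top_minpoly_sextic (K : Type*) [Field K] [Infinite K]
    (L : Type*) [Field L] [Algebra K L] [Algebra.IsSeparable K L]
    (hn : Module.finrank K L = 6) (h2 : ringChar K ≠ 2) :
    ∃ x : L, IntermediateField.adjoin K {x} = ⊤ ∧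
      (minpoly K x).Monic ∧ (minpoly K x).natDegree = 6 ∧
      (minpoly K x).coeff 5 = 0 ∧ (minpoly K x).coeff 3 = 0 := by
  have : FiniteDimensional K L := Module.finite_of_finrank_pos (by omega)
  have h2' : (2 : AlgebraicClosure L) ≠ 0 := by
    have h := Ring.two_ne_zero h2
    rw [← map_ofNat (algebraMap K (AlgebraicClosure L)) 2]
    exact (map_ne_zero _).2 h
  obtain ⟨e⟩ : Nonempty (Fin 6 ≃ (L →ₐ[K] AlgebraicClosure L)) :=
    ⟨Fintype.equivOfCardEq (by rw [AlgHom.card, hn, Fintype.card_fin])⟩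
  -- At a double root the numerator reduces to `2 * c 1 ^ 2`, hence the condition on the
  -- characteristic; the quintic leaves `c 1 ^ 3`, with no such condition.
  obtain ⟨x, y, hx, hy, hxy⟩ := exists_injective_covariant e (by simp)
    (q := sexticCovariant) fun c h0 h1 => by simp [sexticCovariant, h0, h1, h2']
  obtain ⟨hmin, hdeg⟩ := minpoly_map_eq_prod_embeddings (by simp [hn]) e hy
  obtain ⟨h5, h3⟩ := coeff_prod_covariant_sextic hx (y := fun i => e i y) hxy
  rw [← hmin, Polynomial.coeff_map, map_eq_zero] at h5 h3
  exact ⟨y, (Field.primitive_element_iff_minpoly_natDegree_eq K y).2 hdeg,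
    minpoly.monic (Algebra.IsIntegral.isIntegral y), hdeg.trans hn, h5, h3⟩

theorem mainTheorem4 (K : Type*) [Field K] [Infinite K]
    (L : Type*) [Field L] [Algebra K L] [Algebra.IsSeparable K L] :
    (Module.finrank K L = 5 →
      ∃ x : L, IntermediateField.adjoin K {x} = ⊤ ∧
        ∃ b c d : K, minpoly K x =
          (Polynomial.X ^ 5 + Polynomial.C b * Polynomial.X ^ 3
            + Polynomial.C c * Polynomial.X + Polynomial.C d : K[X])) ∧
    (Module.finrank K L = 6 → ringChar K ≠ 2 →
      ∃ x : L, IntermediateField.adjoin K {x} = ⊤ ∧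
        ∃ b c d e : K, minpoly K x =
          (Polynomial.X ^ 6 + Polynomial.C b * Polynomial.X ^ 4
            + Polynomial.C c * Polynomial.X ^ 2 + Polynomial.C d * Polynomial.X
            + Polynomial.C e : K[X])) := by
  refine ⟨fun hn => ?_, fun hn h2 => ?_⟩
  · obtain ⟨x, hx, hmon, hdeg, h4, h2⟩ := exists_adjoin_eq_top_minpoly_quintic K L hn
    refine ⟨x, hx, (minpoly K x).coeff 3, (minpoly K x).coeff 1, (minpoly K x).coeff 0, ?_⟩
    have h := hmon.as_sum
    rw [hdeg] at h
    simp only [Finset.sum_range_succ, Finset.sum_range_zero, h4, h2, map_zero, zero_mul] at h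
    refine h.trans ?_
    ring
  · obtain ⟨x, hx, hmon, hdeg, h5, h3⟩ := exists_adjoin_eq_top_minpoly_sextic K L hn h2
    refine ⟨x, hx, (minpoly K x).coeff 4, (minpoly K x).coeff 2, (minpoly K x).coeff 1,
      (minpoly K x).coeff 0, ?_⟩
    have h := hmon.as_sum
    rw [hdeg] at h
    simp only [Finset.sum_range_succ, Finset.sum_range_zero, h5, h3, map_zero, zero_mul] at h
    refine h.trans ?_
    ring
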